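/- Let $P$ be a finite set of points in the unit square $[0,1]^2$. A \emph{lower-left anchored square packing} for $P$ is a family of closed axis-aligned squares $(s_p)_{p\in P}$ contained in $[0,1]^2$ (squares of side length $0$ are allowed) such that $p$ is the lower-left corner of $s_p$ for every $p\in P$, no point of $P$ lies in the interior of any of the squares, and the squares are pairwise interior-disjoint. Its area is $\sum_{p\in P}\mathrm{area}(s_p)$, and it is \emph{optimal} if no lower-left anchored square packing for $P$ has larger area. The \emph{greedy algorithm} works as follows. Set $Q=P$ and $S=\emptyset$. While $Q\neq\emptyset$, repeat: for each $q\in Q$ let a candidate $s(q)$ be a square of maximum area among the squares that are contained in $[0,1]^2$, have $q$ as their lower-left corner, have no point of $P$ in their interior, and are interior-disjoint from all squares in $S$; choose a point $q\in Q$ whose candidate is largest (ties are broken arbitrarily); replace $Q$ by $Q\setminus\{q\}$ and $S$ by $S\cup\{s(q)\}$. When $Q=\emptyset$, return $S$. \textbf{Theorem.} (i) For every finite $P\subset[0,1]^2$ the greedy algorithm has an output, an optimal packing exists, and every possible output of the greedy algorithm is a lower-left anchored square packing for $P$ whose area is at least $\frac13$ times the area of an optimal packing for $P$. (ii) The constant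 $\frac13$ is best possible for this algorithm: for every $\varepsilon>0$ there is a finite set $P\subset[0,1]^2$ such that, however ties are broken, the area of the packing returned by the greedy algorithm is less than $\left(\frac13+\varepsilon\right)$ times the area of an optimal packing for $P$. -/

import Mathlib

/-- The unit square `[0,1]²`. -/
def unitSquare : Set (ℝ × ℝ) := Set.Icc (0 : ℝ) 1 ×ˢ Set.Icc (0 : ℝ) 1

/-- A closed axis-aligned square, given by its lower-left corner (its anchor) and its side
length. Side length `0`, a single point, is allowed. -/
@[ext] structure LLSquare where
  anchor : ℝ × ℝ
  side : ℝ
  side_nonneg : 0 ≤ side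

namespace LLSquare

/-- The points of the square. -/
def toSet (s : LLSquare) : Set (ℝ × ℝ) :=
  Set.Icc s.anchor.1 (s.anchor.1 + s.side) ×ˢ Set.Icc s.anchor.2 (s.anchor.2 + s.side)

def area (s : LLSquare) : ℝ := s.side ^ 2

/-- The elementary area is the two-dimensional Lebesgue measure of the square. -/
theorem area_eq_volume (s : LLSquare) :
    MeasureTheory.volume s.toSet = ENNReal.ofReal s.area := by
  rw [toSet, MeasureTheory.Measure.volume_eq_prod, MeasureTheory.Measure.prod_prod,
    Real.volume_Icc, Real.volume_Icc, area, sq, ENNReal.ofReal_mul s.side_nonneg]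
  simp

/-- No point of `P` lies in the interior of the square. -/
def IsEmptyOf (s : LLSquare) (P : Finset (ℝ × ℝ)) : Prop :=
  ∀ p ∈ P, p ∉ interior s.toSet

def InteriorDisjoint (s t : LLSquare) : Prop :=
  Disjoint (interior s.toSet) (interior t.toSet)

end LLSquare

/-- The total area of a finite set of squares. -/
def totalArea (S : Finset LLSquare) : ℝ := ∑ s ∈ S, s.area

/-- `S` is a lower-left anchored square packing for `P`: it has exactly one square for each point
of `P`, with that point as its lower-left corner, and no others; the squares lie in the unit
square, have no point of `P` in their interiors, and are pairwise interior-disjoint. -/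
structure IsLLPacking (P : Finset (ℝ × ℝ)) (S : Finset LLSquare) : Prop where
  anchor_mem : ∀ s ∈ S, s.anchor ∈ P
  existsUnique : ∀ p ∈ P, ∃! s, s ∈ S ∧ s.anchor = p
  subset_unitSquare : ∀ s ∈ S, s.toSet ⊆ unitSquare
  isEmptyOf : ∀ s ∈ S, s.IsEmptyOf P
  interiorDisjoint : ∀ s ∈ S, ∀ t ∈ S, s ≠ t → s.InteriorDisjoint t

/-- A lower-left anchored square packing for `P` of maximum total area. -/
def IsOptimalLLPacking (P : Finset (ℝ × ℝ)) (S : Finset LLSquare) : Prop :=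
  IsLLPacking P S ∧ ∀ T, IsLLPacking P T → totalArea T ≤ totalArea S

/-- `s` may be placed at `q` when the squares in `S` have been chosen. -/
structure IsAdmissible (P : Finset (ℝ × ℝ)) (S : Finset LLSquare) (q : ℝ × ℝ)
    (s : LLSquare) : Prop where
  anchor_eq : s.anchor = q
  subset_unitSquare : s.toSet ⊆ unitSquare
  isEmptyOf : s.IsEmptyOf P
  interiorDisjoint : ∀ t ∈ S, s.InteriorDisjoint t

/-- `s` is the candidate square of `q`: an admissible square of maximum area. -/
def IsCandidate (P : Finset (ℝ × ℝ)) (S : Finset LLSquare) (q : ℝ × ℝ) (s : LLSquare) : Prop :=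
  IsAdmissible P S q s ∧ ∀ s', IsAdmissible P S q s' → s'.area ≤ s.area

open Classical in
/-- The states `(Q, S)` that the greedy algorithm can reach on input `P`, where `Q` is the set of
points still to be processed and `S` is the set of squares chosen so far. Each step chooses a
largest one among the candidate squares of the points of `Q`; ties are broken arbitrarily. -/
inductive GreedyReaches (P : Finset (ℝ × ℝ)) : Finset (ℝ × ℝ) → Finset LLSquare → Prop
  | init : GreedyReaches P P ∅
  | step {Q : Finset (ℝ × ℝ)} {S : Finset LLSquare} {q : ℝ × ℝ} {s : LLSquare} :
      GreedyReaches P Q S → q ∈ Q → IsCandidate P S q s →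
      (∀ q' ∈ Q, ∀ s', IsCandidate P S q' s' → s'.area ≤ s.area) →
      GreedyReaches P (Q.erase q) (insert s S)

/-- `S` is returned by some run of the greedy algorithm on input `P`. -/
def IsGreedyOutput (P : Finset (ℝ × ℝ)) (S : Finset LLSquare) : Prop :=
  GreedyReaches P ∅ S

/-!
For the approximation guarantee, run the greedy algorithm and keep, next to it, a packing that
starts as an arbitrary packing `T` and is shrunk after each greedy step just enough to avoid the
squares chosen so far. At every moment the shrunk square at an unprocessed point is admissible, so
the next greedy square, of side `a`, is at least as large as each of them. Those that overlap it
cross its left side or its bottom side. At most one of them sticks out beyond its upper-left corner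
and at most one beyond its lower-right corner, each costing at most `a²`. If `D` and `E` are the
largest depths to which the remaining ones enter from the left and from the bottom, their overlaps
have total area at most `D a + (a - D) E`, and shrinking a square of side `r` entered to depth `d`
costs `2 d r - d²`, so the remaining ones cost together at most
`2 (D a + (a - D) E) - D² - E² = a² - (a - D - E)² ≤ a²`. A greedy step thus costs `T` at most
three times the area that it gains, and in the end nothing of `T` is left.

The bound is sharp for the corners `(0, 0)`, `(0, 1/2)`, `(1/2, 0)` of three quadrants, together
with closely spaced points on the diagonal of the fourth one. The three quadrants have area `3/4`,
but the greedy algorithm first places a square slightly larger than a quadrant at the origin, which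
leaves no room at the other two corners.
-/

open MeasureTheory

/-! ### Open squares -/

/-- The open axis-aligned square with lower-left corner `p` and side length `r`; it is empty for
`r ≤ 0`. -/
def openSq (p : ℝ × ℝ) (r : ℝ) : Set (ℝ × ℝ) :=
  Set.Ioo p.1 (p.1 + r) ×ˢ Set.Ioo p.2 (p.2 + r)

section OpenSquares

variable {p q x : ℝ × ℝ} {a r s : ℝ}

theorem mem_openSq :
    x ∈ openSq p r ↔ (p.1 < x.1 ∧ x.1 < p.1 + r) ∧ p.2 < x.2 ∧ x.2 < p.2 + r :=
  Iff.rfl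

theorem openSq_zero (p : ℝ × ℝ) : openSq p 0 = ∅ := by
  simp [openSq]

theorem openSq_mono (h : r ≤ s) : openSq p r ⊆ openSq p s :=
  Set.prod_mono (Set.Ioo_subset_Ioo_right (by linarith)) (Set.Ioo_subset_Ioo_right (by linarith))

theorem measurableSet_openSq (p : ℝ × ℝ) (r : ℝ) : MeasurableSet (openSq p r) :=
  measurableSet_Ioo.prod measurableSet_Ioo

theorem not_disjoint_openSq :
    ¬ Disjoint (openSq q r) (openSq p a) ↔
      (0 < r ∧ 0 < a) ∧ (q.1 < p.1 + a ∧ p.1 < q.1 + r) ∧ q.2 < p.2 + a ∧ p.2 < q.2 + r := by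
  rw [openSq, openSq, Set.disjoint_prod, Set.Ioo_disjoint_Ioo, Set.Ioo_disjoint_Ioo]
  simp only [not_or, not_le, lt_min_iff, max_lt_iff]
  grind

theorem disjoint_openSq_swap :
    Disjoint (openSq p.swap r) (openSq q.swap s) ↔ Disjoint (openSq p r) (openSq q s) := by
  simp only [openSq, Set.disjoint_prod, Prod.fst_swap, Prod.snd_swap]
  exact or_comm

theorem nonpos_of_disjoint_openSq_self (hra : r ≤ a)
    (h : Disjoint (openSq p r) (openSq p a)) : r ≤ 0 := by
  by_contra! hr
  exact not_disjoint_openSq.2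
    ⟨⟨hr, by linarith⟩, ⟨by linarith, by linarith⟩, by linarith, by linarith⟩ h

theorem volume_real_inter_openSq_swap :
    volume.real (openSq p.swap r ∩ openSq q.swap s) = volume.real (openSq p r ∩ openSq q s) := by
  simp only [openSq, Set.prod_inter_prod, Measure.volume_eq_prod, measureReal_prod_prod,
    Prod.fst_swap, Prod.snd_swap]
  exact mul_comm _ _

theorem isClosed_setOf_notMem_openSq {X : Type*} [TopologicalSpace X] {f : X → ℝ}
    (hf : Continuous f) (p q : ℝ × ℝ) : IsClosed {x | q ∉ openSq p (f x)} := by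
  have hopen : IsOpen {x | q ∈ openSq p (f x)} := by
    simp only [mem_openSq]
    exact (isOpen_const.and (isOpen_lt continuous_const (by fun_prop))).and
      (isOpen_const.and (isOpen_lt continuous_const (by fun_prop)))
  exact hopen.isClosed_compl

theorem isClosed_setOf_disjoint_openSq {X : Type*} [TopologicalSpace X] {f g : X → ℝ}
    (hf : Continuous f) (hg : Continuous g) (p q : ℝ × ℝ) :
    IsClosed {x | Disjoint (openSq p (f x)) (openSq q (g x))} := by
  have hopen : IsOpen {x | ¬ Disjoint (openSq p (f x)) (openSq q (g x))} := by
    simp only [not_disjoint_openSq]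
    refine IsOpen.and (IsOpen.and ?_ ?_) (IsOpen.and (IsOpen.and ?_ ?_) (IsOpen.and ?_ ?_)) <;>
      exact isOpen_lt (by fun_prop) (by fun_prop)
  simpa [Set.compl_ofPred] using hopen.isClosed_compl

end OpenSquares

/-! ### Squares crossing the sides of another square -/

/-- The square with lower-left corner `q` and side length `r` crosses the left side of the square
with lower-left corner `p` and side length `a`, and does not reach below it. Crossing the bottom
side is expressed by exchanging the coordinates, as `CrossesLeft p.swap a q.swap r`. -/
structure CrossesLeft (p : ℝ × ℝ) (a : ℝ) (q : ℝ × ℝ) (r : ℝ) : Prop where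
  fst_le : q.1 ≤ p.1
  lt_fst_add : p.1 < q.1 + r
  le_snd : p.2 ≤ q.2
  snd_lt_add : q.2 < p.2 + a

section Crossing

variable {p q q' : ℝ × ℝ} {a r r' : ℝ}

theorem CrossesLeft.not_disjoint (h : CrossesLeft p a q r) :
    ¬ Disjoint (openSq q r) (openSq p a) := by
  obtain ⟨h₁, h₂, h₃, h₄⟩ := h
  exact not_disjoint_openSq.2
    ⟨⟨by linarith, by linarith⟩, ⟨by linarith, by linarith⟩, by linarith, by linarith⟩

theorem crossesLeft_or_crossesLeft_swap (h : ¬ Disjoint (openSq q r) (openSq p a))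
    (hp : p ∉ openSq q r) (hq : q ∉ openSq p a) :
    CrossesLeft p a q r ∨ CrossesLeft p.swap a q.swap r := by
  obtain ⟨-, ⟨h₁, h₂⟩, h₃, h₄⟩ := not_disjoint_openSq.1 h
  rw [mem_openSq] at hp hq
  rcases le_or_gt q.1 p.1 with hfst | hfst <;> rcases le_or_gt p.2 q.2 with hsnd | hsnd
  · exact .inl ⟨hfst, h₂, hsnd, h₃⟩
  · rcases hfst.eq_or_lt with heq | hlt
    · exact .inr ⟨hsnd.le, h₄, heq.ge, h₁⟩
    · exact (hp ⟨⟨hlt, h₂⟩, hsnd, h₄⟩).elim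
  · rcases hsnd.eq_or_lt with heq | hlt
    · exact .inr ⟨heq.ge, h₄, hfst.le, h₁⟩
    · exact (hq ⟨⟨hfst, h₁⟩, hlt, h₃⟩).elim
  · exact .inr ⟨hsnd.le, h₄, hfst.le, h₁⟩

theorem CrossesLeft.volume_real_inter (h : CrossesLeft p a q r) (htop : q.2 + r ≤ p.2 + a) :
    volume.real (openSq q r ∩ openSq p a) = (q.1 + r - p.1) * r := by
  obtain ⟨h₁, h₂, h₃, -⟩ := h
  rw [openSq, openSq, Set.prod_inter_prod, Set.Ioo_inter_Ioo, Set.Ioo_inter_Ioo,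
    sup_eq_right.2 h₁, sup_eq_left.2 h₃, inf_eq_left.2 htop, inf_eq_left.2 (by linarith),
    Measure.volume_eq_prod, measureReal_prod_prod, Real.volume_real_Ioo_of_le h₂.le,
    Real.volume_real_Ioo_of_le (by linarith), add_sub_cancel_left]

/-- Both squares contain the points just to the lower right of the upper-left corner. -/
theorem CrossesLeft.not_disjoint_of_protrudes (h : CrossesLeft p a q r)
    (htop : p.2 + a < q.2 + r) (h' : CrossesLeft p a q' r') (htop' : p.2 + a < q'.2 + r') :
    ¬ Disjoint (openSq q r) (openSq q' r') := by
  obtain ⟨h₁, h₂, -, h₄⟩ := h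
  obtain ⟨h₁', h₂', -, h₄'⟩ := h'
  exact not_disjoint_openSq.2
    ⟨⟨by linarith, by linarith⟩, ⟨by linarith, by linarith⟩, by linarith, by linarith⟩

end Crossing

section FamiliesOfCrossingSquares

variable {ι : Type*} {J A B : Finset ι} {c : ι → ℝ × ℝ} {r : ι → ℝ} {p : ℝ × ℝ} {a : ℝ}

theorem card_le_one_of_crossesLeft_of_protrudes
    (hd : (J : Set ι).PairwiseDisjoint fun i => openSq (c i) (r i))
    (hJ : ∀ i ∈ J, CrossesLeft p a (c i) (r i) ∧ p.2 + a < (c i).2 + r i) : J.card ≤ 1 := by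
  refine Finset.card_le_one.2 fun i hi j hj => ?_
  by_contra hij
  exact (hJ i hi).1.not_disjoint_of_protrudes (hJ i hi).2 (hJ j hj).1 (hJ j hj).2 (hd hi hj hij)

theorem sum_le_of_card_le_one {g : ι → ℝ} {b : ℝ} (hb : 0 ≤ b) (hJ : J.card ≤ 1)
    (hg : ∀ i ∈ J, g i ≤ b) : ∑ i ∈ J, g i ≤ b :=
  calc ∑ i ∈ J, g i ≤ J.card • b := Finset.sum_le_card_nsmul _ _ _ hg
    _ ≤ 1 • b := nsmul_le_nsmul_left hb hJ
    _ = b := one_nsmul b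

theorem volume_real_Icc_prod_Icc {x₁ x₂ y₁ y₂ : ℝ} (hx : x₁ ≤ x₂) (hy : y₁ ≤ y₂) :
    volume.real (Set.Icc x₁ x₂ ×ˢ Set.Icc y₁ y₂) = (x₂ - x₁) * (y₂ - y₁) := by
  rw [Measure.volume_eq_prod, measureReal_prod_prod, Real.volume_real_Icc_of_le hx,
    Real.volume_real_Icc_of_le hy]

/-- The overlaps lie in the union of a `D × a` and an `(a - D) × E` rectangle. -/
theorem sum_depth_mul_side_le {D E : ℝ} (hD₀ : 0 ≤ D) (hDa : D ≤ a) (hE₀ : 0 ≤ E)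
    (hAB : Disjoint A B)
    (hd : ((A : Set ι) ∪ B).PairwiseDisjoint fun i => openSq (c i) (r i))
    (hA : ∀ i ∈ A, CrossesLeft p a (c i) (r i) ∧ (c i).2 + r i ≤ p.2 + a)
    (hB : ∀ i ∈ B, CrossesLeft p.swap a (c i).swap (r i) ∧ (c i).1 + r i ≤ p.1 + a)
    (hD : ∀ i ∈ A, (c i).1 + r i - p.1 ≤ D) (hE : ∀ i ∈ B, (c i).2 + r i - p.2 ≤ E) :
    ∑ i ∈ A, ((c i).1 + r i - p.1) * r i + ∑ i ∈ B, ((c i).2 + r i - p.2) * r i ≤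
      D * a + (a - D) * E := by
  classical
  let overlap (i : ι) : Set (ℝ × ℝ) := openSq (c i) (r i) ∩ openSq p a
  let U₁ : Set (ℝ × ℝ) := Set.Icc p.1 (p.1 + D) ×ˢ Set.Icc p.2 (p.2 + a)
  let U₂ : Set (ℝ × ℝ) := Set.Icc (p.1 + D) (p.1 + a) ×ˢ Set.Icc p.2 (p.2 + E)
  have hfin : volume (U₁ ∪ U₂) ≠ ⊤ :=
    ((isCompact_Icc.prod isCompact_Icc).union (isCompact_Icc.prod isCompact_Icc)).measure_ne_top
  have hsub : ∀ i ∈ A ∪ B, overlap i ⊆ U₁ ∪ U₂ := by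
    rintro i hi x ⟨⟨⟨-, hx₁⟩, -, hx₂⟩, ⟨hx₃, hx₄⟩, hx₅, hx₆⟩
    rcases le_or_gt x.1 (p.1 + D) with hxD | hxD
    · exact .inl ⟨⟨hx₃.le, hxD⟩, hx₅.le, hx₆.le⟩
    · rcases Finset.mem_union.1 hi with hi | hi
      · linarith [hD i hi]
      · exact .inr ⟨⟨hxD.le, hx₄.le⟩, hx₅.le, by linarith [hE i hi]⟩
  calc _ = ∑ i ∈ A ∪ B, volume.real (overlap i) := by
        rw [Finset.sum_union hAB]
        refine congrArg₂ _ (Finset.sum_congr rfl fun i hi => ?_)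
          (Finset.sum_congr rfl fun i hi => ?_)
        · exact ((hA i hi).1.volume_real_inter (hA i hi).2).symm
        · exact (volume_real_inter_openSq_swap.symm.trans
            ((hB i hi).1.volume_real_inter (hB i hi).2)).symm
    _ = volume.real (⋃ i ∈ A ∪ B, overlap i) := by
        refine (measureReal_biUnion_finset ?_
          (fun i _ => (measurableSet_openSq _ _).inter (measurableSet_openSq _ _))
          (fun i hi => measure_ne_top_of_subset (hsub i hi) hfin)).symm
        rw [Finset.coe_union]
        exact hd.mono fun i => Set.inter_subset_left
    _ ≤ volume.real (U₁ ∪ U₂) := measureReal_mono (Set.iUnion₂_subset hsub) hfin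
    _ ≤ volume.real U₁ + volume.real U₂ := measureReal_union_le _ _
    _ = D * a + (a - D) * E := by
        rw [volume_real_Icc_prod_Icc (by linarith) (by linarith),
          volume_real_Icc_prod_Icc (by linarith) (by linarith)]
        ring

theorem exists_forall_le_and_sq_le_sum_sq {d : ι → ℝ} (ha : 0 ≤ a)
    (hd : ∀ i ∈ J, 0 ≤ d i ∧ d i ≤ a) :
    ∃ D, 0 ≤ D ∧ D ≤ a ∧ (∀ i ∈ J, d i ≤ D) ∧ D ^ 2 ≤ ∑ i ∈ J, d i ^ 2 := by
  rcases J.eq_empty_or_nonempty with rfl | hJ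
  · exact ⟨0, le_rfl, ha, by simp, by simp⟩
  · obtain ⟨i, hi, hmax⟩ := J.exists_max_image d hJ
    exact ⟨d i, (hd i hi).1, (hd i hi).2, hmax,
      Finset.single_le_sum (f := fun i => d i ^ 2) (fun j _ => sq_nonneg _) hi⟩

theorem sum_sq_sub_sq_le_of_crossesLeft (ha : 0 ≤ a) (hAB : Disjoint A B)
    (hd : ((A : Set ι) ∪ B).PairwiseDisjoint fun i => openSq (c i) (r i))
    (hA : ∀ i ∈ A, CrossesLeft p a (c i) (r i) ∧ (c i).2 + r i ≤ p.2 + a)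
    (hB : ∀ i ∈ B, CrossesLeft p.swap a (c i).swap (r i) ∧ (c i).1 + r i ≤ p.1 + a) :
    ∑ i ∈ A, (r i ^ 2 - (p.1 - (c i).1) ^ 2) + ∑ i ∈ B, (r i ^ 2 - (p.2 - (c i).2) ^ 2) ≤
      a ^ 2 := by
  obtain ⟨D, hD₀, hDa, hD, hDsq⟩ :=
    exists_forall_le_and_sq_le_sum_sq (J := A) (d := fun i => (c i).1 + r i - p.1) ha
      fun i hi => by
        obtain ⟨⟨h₁, h₂, h₃, -⟩, htop⟩ := hA i hi
        constructor <;> linarith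
  obtain ⟨E, hE₀, -, hE, hEsq⟩ :=
    exists_forall_le_and_sq_le_sum_sq (J := B) (d := fun i => (c i).2 + r i - p.2) ha
      fun i hi => by
        obtain ⟨⟨h₁, h₂, h₃, -⟩, hright⟩ := hB i hi
        simp only [Prod.fst_swap, Prod.snd_swap] at h₁ h₂ h₃
        constructor <;> linarith
  have hoverlap := sum_depth_mul_side_le hD₀ hDa hE₀ hAB hd hA hB hD hE
  have hcost (x y t : ℝ) : t ^ 2 - (y - x) ^ 2 = 2 * ((x + t - y) * t) - (x + t - y) ^ 2 := by
    ring
  simp only [hcost, Finset.sum_sub_distrib, ← Finset.mul_sum]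
  linarith [sq_nonneg (a - D - E)]

end FamiliesOfCrossingSquares

/-! ### Shrinking squares to avoid another square -/

open Classical in
/-- The side length to which the square with lower-left corner `q` and side length `r` is shrunk
when a square with lower-left corner `p` and side length `a` is added: if the two overlap, it is
the largest one that avoids the overlap. -/
noncomputable def shrunkSide (p : ℝ × ℝ) (a : ℝ) (q : ℝ × ℝ) (r : ℝ) : ℝ :=
  if Disjoint (openSq q r) (openSq p a) then r else max (p.1 - q.1) (p.2 - q.2)

section Shrinking

variable {p q : ℝ × ℝ} {a r : ℝ}

theorem shrunkSide_of_disjoint (h : Disjoint (openSq q r) (openSq p a)) :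
    shrunkSide p a q r = r :=
  if_pos h

theorem shrunkSide_of_not_disjoint (h : ¬ Disjoint (openSq q r) (openSq p a)) :
    shrunkSide p a q r = max (p.1 - q.1) (p.2 - q.2) :=
  if_neg h

theorem shrunkSide_swap : shrunkSide p.swap a q.swap r = shrunkSide p a q r := by
  by_cases h : Disjoint (openSq q r) (openSq p a)
  · rw [shrunkSide_of_disjoint h, shrunkSide_of_disjoint (disjoint_openSq_swap.2 h)]
  · rw [shrunkSide_of_not_disjoint h,
      shrunkSide_of_not_disjoint (disjoint_openSq_swap.not.2 h)]
    exact max_comm _ _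

theorem shrunkSide_le : shrunkSide p a q r ≤ r := by
  by_cases h : Disjoint (openSq q r) (openSq p a)
  · exact (shrunkSide_of_disjoint h).le
  · obtain ⟨-, ⟨-, h₁⟩, -, h₂⟩ := not_disjoint_openSq.1 h
    rw [shrunkSide_of_not_disjoint h]
    exact max_le (by linarith) (by linarith)

theorem shrunkSide_nonneg (hr : 0 ≤ r) (hq : q ∉ openSq p a) : 0 ≤ shrunkSide p a q r := by
  by_cases h : Disjoint (openSq q r) (openSq p a)
  · rwa [shrunkSide_of_disjoint h]
  · obtain ⟨-, ⟨h₁, -⟩, h₂, -⟩ := not_disjoint_openSq.1 h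
    rw [shrunkSide_of_not_disjoint h]
    by_contra! hneg
    obtain ⟨h₃, h₄⟩ := max_lt_iff.1 hneg
    exact hq ⟨⟨by linarith, h₁⟩, by linarith, h₂⟩

theorem disjoint_openSq_shrunkSide :
    Disjoint (openSq q (shrunkSide p a q r)) (openSq p a) := by
  by_cases h : Disjoint (openSq q r) (openSq p a)
  · rwa [shrunkSide_of_disjoint h]
  · rw [shrunkSide_of_not_disjoint h]
    by_contra hoverlap
    obtain ⟨-, ⟨-, h₁⟩, -, h₂⟩ := not_disjoint_openSq.1 hoverlap
    rcases max_cases (p.1 - q.1) (p.2 - q.2) with hmax | hmax <;> linarith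

theorem CrossesLeft.shrunkSide_eq (h : CrossesLeft p a q r) :
    shrunkSide p a q r = p.1 - q.1 := by
  rw [shrunkSide_of_not_disjoint h.not_disjoint]
  exact max_eq_left (by linarith [h.fst_le, h.le_snd])

theorem CrossesLeft.shrunkSide_swap_eq (h : CrossesLeft p.swap a q.swap r) :
    shrunkSide p a q r = p.2 - q.2 :=
  shrunkSide_swap.symm.trans h.shrunkSide_eq

end Shrinking

section ShrinkingFamilies

variable {ι : Type*} {J A B : Finset ι} {c : ι → ℝ × ℝ} {r : ι → ℝ} {p : ℝ × ℝ} {a : ℝ}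

theorem sum_sq_sub_shrunkSide_sq_le_of_protrudes (hra : ∀ i ∈ J, r i ≤ a)
    (hd : (J : Set ι).PairwiseDisjoint fun i => openSq (c i) (r i))
    (hJ : ∀ i ∈ J, CrossesLeft p a (c i) (r i) ∧ p.2 + a < (c i).2 + r i) :
    ∑ i ∈ J, (r i ^ 2 - shrunkSide p a (c i) (r i) ^ 2) ≤ a ^ 2 := by
  refine sum_le_of_card_le_one (sq_nonneg a) (card_le_one_of_crossesLeft_of_protrudes hd hJ)
    fun i hi => ?_
  have hr₀ : 0 ≤ r i := (not_disjoint_openSq.1 (hJ i hi).1.not_disjoint).1.1.le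
  exact (sub_le_self _ (sq_nonneg _)).trans (pow_le_pow_left₀ hr₀ (hra i hi) 2)

theorem sum_sq_sub_shrunkSide_sq_le_of_crossesLeft (ha : 0 ≤ a) (hAB : Disjoint A B)
    (hra : ∀ i, i ∈ A ∨ i ∈ B → r i ≤ a)
    (hd : ((A : Set ι) ∪ B).PairwiseDisjoint fun i => openSq (c i) (r i))
    (hA : ∀ i ∈ A, CrossesLeft p a (c i) (r i))
    (hB : ∀ i ∈ B, CrossesLeft p.swap a (c i).swap (r i)) :
    ∑ i ∈ A, (r i ^ 2 - shrunkSide p a (c i) (r i) ^ 2) +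
      ∑ i ∈ B, (r i ^ 2 - shrunkSide p a (c i) (r i) ^ 2) ≤ 3 * a ^ 2 := by
  classical
  let A₀ := A.filter fun i => (c i).2 + r i ≤ p.2 + a
  let A₁ := A.filter fun i => ¬ (c i).2 + r i ≤ p.2 + a
  let B₀ := B.filter fun i => (c i).1 + r i ≤ p.1 + a
  let B₁ := B.filter fun i => ¬ (c i).1 + r i ≤ p.1 + a
  have hcostA : ∀ i ∈ A₀, r i ^ 2 - shrunkSide p a (c i) (r i) ^ 2 =
      r i ^ 2 - (p.1 - (c i).1) ^ 2 := fun i hi => by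
    rw [(hA i (Finset.mem_of_mem_filter i hi)).shrunkSide_eq]
  have hcostB : ∀ i ∈ B₀, r i ^ 2 - shrunkSide p a (c i) (r i) ^ 2 =
      r i ^ 2 - (p.2 - (c i).2) ^ 2 := fun i hi => by
    rw [(hB i (Finset.mem_of_mem_filter i hi)).shrunkSide_swap_eq]
  have hA₁ := sum_sq_sub_shrunkSide_sq_le_of_protrudes (J := A₁) (c := c) (r := r) (p := p) (a := a)
    (by grind) (hd.subset (by grind)) (by grind)
  have hB₁ := sum_sq_sub_shrunkSide_sq_le_of_protrudes (J := B₁) (c := fun i => (c i).swap) (r := r)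
    (p := p.swap) (a := a) (by grind)
    (fun i hi j hj hij => disjoint_openSq_swap.2 (hd (by grind) (by grind) hij)) (by grind)
  have h₀ := sum_sq_sub_sq_le_of_crossesLeft (A := A₀) (B := B₀) (p := p) ha
    (hAB.mono (Finset.filter_subset _ _) (Finset.filter_subset _ _)) (hd.subset (by grind))
    (by grind) (by grind)
  simp only [shrunkSide_swap] at hB₁
  rw [← Finset.sum_congr rfl hcostA, ← Finset.sum_congr rfl hcostB] at h₀
  rw [← Finset.sum_filter_add_sum_filter_not A fun i => (c i).2 + r i ≤ p.2 + a,
    ← Finset.sum_filter_add_sum_filter_not B fun i => (c i).1 + r i ≤ p.1 + a]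
  linarith

theorem sum_sq_sub_shrunkSide_sq_le (ha : 0 ≤ a) (hra : ∀ i ∈ J, r i ≤ a)
    (hd : (J : Set ι).PairwiseDisjoint fun i => openSq (c i) (r i))
    (hp : ∀ i ∈ J, p ∉ openSq (c i) (r i)) (hc : ∀ i ∈ J, c i ∉ openSq p a) :
    ∑ i ∈ J, (r i ^ 2 - shrunkSide p a (c i) (r i) ^ 2) ≤ 3 * a ^ 2 := by
  classical
  let O := J.filter fun i => ¬ Disjoint (openSq (c i) (r i)) (openSq p a)
  let B := O.filter fun i => ¬ CrossesLeft p a (c i) (r i)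
  have hzero : ∀ i ∈ J, r i ^ 2 - shrunkSide p a (c i) (r i) ^ 2 ≠ 0 →
      ¬ Disjoint (openSq (c i) (r i)) (openSq p a) := fun i _ hne hdisj =>
    hne (by rw [shrunkSide_of_disjoint hdisj, sub_self])
  have hB : ∀ i ∈ B, CrossesLeft p.swap a (c i).swap (r i) := fun i hi => by
    obtain ⟨hiO, hleft⟩ := Finset.mem_filter.1 hi
    obtain ⟨hiJ, hover⟩ := Finset.mem_filter.1 hiO
    exact (crossesLeft_or_crossesLeft_swap hover (hp i hiJ) (hc i hiJ)).resolve_left hleft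
  rw [← Finset.sum_filter_of_ne hzero,
    ← Finset.sum_filter_add_sum_filter_not O fun i => CrossesLeft p a (c i) (r i)]
  exact sum_sq_sub_shrunkSide_sq_le_of_crossesLeft ha (Finset.disjoint_filter_filter_not O O _)
    (by grind) (hd.subset (by grind)) (fun i hi => (Finset.mem_filter.1 hi).2) hB

end ShrinkingFamilies

/-! ### Packings as families of side lengths -/

/-- The square with lower-left corner `q` and side length `r` may be placed as far as the upper and
right sides of the unit square and the points of `P` are concerned. -/
structure FitsAt (P : Finset (ℝ × ℝ)) (q : ℝ × ℝ) (r : ℝ) : Prop where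
  fst_le : q.1 + r ≤ 1
  snd_le : q.2 + r ≤ 1
  notMem : ∀ p ∈ P, p ∉ openSq q r

section FitsAt

variable {P : Finset (ℝ × ℝ)} {q : ℝ × ℝ} {r r' : ℝ}

theorem FitsAt.mono (h : FitsAt P q r) (hr : r' ≤ r) : FitsAt P q r' where
  fst_le := by linarith [h.fst_le]
  snd_le := by linarith [h.snd_le]
  notMem p hp hmem := h.notMem p hp (openSq_mono hr hmem)

theorem fitsAt_zero (P : Finset (ℝ × ℝ)) (hq : q ∈ unitSquare) : FitsAt P q 0 where
  fst_le := by simpa using hq.1.2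
  snd_le := by simpa using hq.2.2
  notMem p _ := by simp [openSq_zero]

theorem FitsAt.le_one (h : FitsAt P q r) (hq : q ∈ unitSquare) : r ≤ 1 := by
  linarith [h.fst_le, hq.1.1]

theorem isClosed_setOf_fitsAt {X : Type*} [TopologicalSpace X] {f : X → ℝ} (hf : Continuous f)
    (P : Finset (ℝ × ℝ)) (q : ℝ × ℝ) : IsClosed {x | FitsAt P q (f x)} := by
  have heq : {x | FitsAt P q (f x)} = {x | q.1 + f x ≤ 1} ∩ {x | q.2 + f x ≤ 1} ∩
      ⋂ p ∈ P, {x | p ∉ openSq q (f x)} := by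
    ext x
    simp only [Set.mem_inter_iff, Set.mem_iInter, Set.mem_ofPred_eq]
    exact ⟨fun h => ⟨⟨h.fst_le, h.snd_le⟩, h.notMem⟩, fun h => ⟨h.1.1, h.1.2, h.2⟩⟩
  rw [heq]
  exact ((isClosed_le (by fun_prop) continuous_const).inter
    (isClosed_le (by fun_prop) continuous_const)).inter
      (isClosed_biInter fun p _ => isClosed_setOf_notMem_openSq hf q p)

end FitsAt

namespace LLSquare

variable {s t : LLSquare}

theorem interior_toSet (s : LLSquare) : interior s.toSet = openSq s.anchor s.side := by
  rw [toSet, interior_prod_eq, interior_Icc, interior_Icc, openSq]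

theorem interiorDisjoint_iff :
    s.InteriorDisjoint t ↔ Disjoint (openSq s.anchor s.side) (openSq t.anchor t.side) := by
  rw [InteriorDisjoint, interior_toSet, interior_toSet]

theorem subset_unitSquare_iff (hs : s.anchor ∈ unitSquare) :
    s.toSet ⊆ unitSquare ↔ s.anchor.1 + s.side ≤ 1 ∧ s.anchor.2 + s.side ≤ 1 := by
  have hside := s.side_nonneg
  obtain ⟨⟨h₁, -⟩, h₂, -⟩ := hs
  have hfst : s.anchor.1 ≤ s.anchor.1 + s.side := by linarith
  have hsnd : s.anchor.2 ≤ s.anchor.2 + s.side := by linarith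
  rw [toSet, unitSquare, Set.prod_subset_prod_iff, Set.Icc_subset_Icc_iff hfst,
    Set.Icc_subset_Icc_iff hsnd, Set.Icc_eq_empty_iff, Set.Icc_eq_empty_iff]
  tauto

theorem fitsAt_iff (P : Finset (ℝ × ℝ)) (hs : s.anchor ∈ unitSquare) :
    FitsAt P s.anchor s.side ↔ s.toSet ⊆ unitSquare ∧ s.IsEmptyOf P := by
  rw [subset_unitSquare_iff hs, IsEmptyOf, interior_toSet]
  exact ⟨fun h => ⟨⟨h.fst_le, h.snd_le⟩, h.notMem⟩, fun h => ⟨h.1.1, h.1.2, h.2⟩⟩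

theorem area_le_area_iff : s.area ≤ t.area ↔ s.side ≤ t.side :=
  pow_le_pow_iff_left₀ s.side_nonneg t.side_nonneg two_ne_zero

end LLSquare

/-- The numbers `f p` are the side lengths of a lower-left anchored square packing for `P`. They
are required to vanish outside `P`, which makes the set of all such families `f` compact. -/
structure IsSidePacking (P : Finset (ℝ × ℝ)) (f : ℝ × ℝ → ℝ) : Prop where
  eq_zero : ∀ p ∉ P, f p = 0
  nonneg : ∀ p, 0 ≤ f p
  fitsAt : ∀ p ∈ P, FitsAt P p (f p)
  disjoint : (P : Set (ℝ × ℝ)).PairwiseDisjoint fun p => openSq p (f p)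

section SidePackings

variable {P : Finset (ℝ × ℝ)} {f g : ℝ × ℝ → ℝ}

theorem IsSidePacking.mono (hf : IsSidePacking P f) (hg : ∀ p, 0 ≤ g p) (hgf : ∀ p, g p ≤ f p) :
    IsSidePacking P g where
  eq_zero p hp := le_antisymm (hf.eq_zero p hp ▸ hgf p) (hg p)
  nonneg := hg
  fitsAt p hp := (hf.fitsAt p hp).mono (hgf p)
  disjoint := hf.disjoint.mono fun p => openSq_mono (hgf p)

theorem isSidePacking_zero (hP : ∀ p ∈ P, p ∈ unitSquare) : IsSidePacking P 0 where
  eq_zero _ _ := rfl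
  nonneg _ := le_rfl
  fitsAt p hp := fitsAt_zero P (hP p hp)
  disjoint p _ q _ _ := by simp [openSq_zero]

theorem IsSidePacking.le_one (hf : IsSidePacking P f) (hP : ∀ p ∈ P, p ∈ unitSquare) (p : ℝ × ℝ) :
    f p ≤ 1 := by
  by_cases hp : p ∈ P
  · exact (hf.fitsAt p hp).le_one (hP p hp)
  · simp [hf.eq_zero p hp]

theorem isClosed_setOf_isSidePacking (P : Finset (ℝ × ℝ)) : IsClosed {f | IsSidePacking P f} := by
  have heq : {f | IsSidePacking P f} = (⋂ p ∉ P, {f | f p = 0}) ∩ (⋂ p, {f | 0 ≤ f p}) ∩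
      (⋂ p ∈ P, {f | FitsAt P p (f p)}) ∩
      ⋂ p ∈ P, ⋂ q ∈ P, ⋂ _ : p ≠ q, {f | Disjoint (openSq p (f p)) (openSq q (f q))} := by
    ext f
    simp only [Set.mem_inter_iff, Set.mem_iInter, Set.mem_ofPred_eq]
    exact ⟨fun h => ⟨⟨⟨h.eq_zero, h.nonneg⟩, h.fitsAt⟩, fun p hp q hq hpq => h.disjoint hp hq hpq⟩,
      fun h => ⟨h.1.1.1, h.1.1.2, h.1.2, fun p hp q hq hpq => h.2 p hp q hq hpq⟩⟩
  rw [heq]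
  refine IsClosed.inter (IsClosed.inter (IsClosed.inter ?_ ?_) ?_) ?_
  · exact isClosed_biInter fun p _ => isClosed_eq (continuous_apply p) continuous_const
  · exact isClosed_iInter fun p => isClosed_le continuous_const (continuous_apply p)
  · exact isClosed_biInter fun p _ => isClosed_setOf_fitsAt (continuous_apply p) P p
  · exact isClosed_biInter fun p _ => isClosed_biInter fun q _ => isClosed_iInter fun _ =>
      isClosed_setOf_disjoint_openSq (continuous_apply p) (continuous_apply q) p q

theorem isCompact_setOf_isSidePacking (hP : ∀ p ∈ P, p ∈ unitSquare) :
    IsCompact {f | IsSidePacking P f} :=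
  (isCompact_univ_pi fun _ => isCompact_Icc (a := (0 : ℝ)) (b := 1)).of_isClosed_subset
    (isClosed_setOf_isSidePacking P) fun _ hf p _ => ⟨hf.nonneg p, hf.le_one hP p⟩

theorem IsSidePacking.exists_isLLPacking (h : IsSidePacking P f) (hP : ∀ p ∈ P, p ∈ unitSquare) :
    ∃ S, IsLLPacking P S ∧ totalArea S = ∑ p ∈ P, f p ^ 2 := by
  classical
  let square (p : ℝ × ℝ) : LLSquare := ⟨p, f p, h.nonneg p⟩
  have hfits : ∀ p ∈ P, (square p).toSet ⊆ unitSquare ∧ (square p).IsEmptyOf P := fun p hp =>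
    (LLSquare.fitsAt_iff (s := square p) P (hP p hp)).1 (h.fitsAt p hp)
  refine ⟨P.image square, ⟨?_, fun p hp => ⟨square p, ⟨Finset.mem_image_of_mem _ hp, rfl⟩, ?_⟩,
    ?_, ?_, ?_⟩, Finset.sum_image fun p _ q _ hpq => congrArg LLSquare.anchor hpq⟩
  · exact Finset.forall_mem_image.2 fun p hp => hp
  · rintro s ⟨hs, rfl⟩
    obtain ⟨q, -, rfl⟩ := Finset.mem_image.1 hs
    rfl
  · exact Finset.forall_mem_image.2 fun p hp => (hfits p hp).1
  · exact Finset.forall_mem_image.2 fun p hp => (hfits p hp).2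
  · refine Finset.forall_mem_image.2 fun p hp => Finset.forall_mem_image.2 fun q hq hpq => ?_
    exact LLSquare.interiorDisjoint_iff.2 (h.disjoint hp hq (ne_of_apply_ne square hpq))

end SidePackings

open Classical in
/-- The side length of the square with lower-left corner `p` in the set `S` of squares; it is `0`
if there is no such square. The definition by a sum is meant for sets `S` that contain at most one
such square. -/
noncomputable def sideAt (S : Finset LLSquare) (p : ℝ × ℝ) : ℝ :=
  ∑ s ∈ S with s.anchor = p, s.side

namespace IsLLPacking

variable {P : Finset (ℝ × ℝ)} {S : Finset LLSquare} {s : LLSquare}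

theorem anchor_injOn (h : IsLLPacking P S) : Set.InjOn LLSquare.anchor (S : Set LLSquare) :=
  fun s hs _ ht hst => (h.existsUnique _ (h.anchor_mem s hs)).unique ⟨hs, rfl⟩ ⟨ht, hst.symm⟩

theorem sideAt_anchor (h : IsLLPacking P S) (hs : s ∈ S) : sideAt S s.anchor = s.side := by
  classical
  have hfilter : S.filter (fun t => t.anchor = s.anchor) = {s} := by
    ext t
    simp only [Finset.mem_filter, Finset.mem_singleton]
    exact ⟨fun ht => h.anchor_injOn ht.1 hs ht.2, by rintro rfl; exact ⟨hs, rfl⟩⟩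
  rw [sideAt, hfilter, Finset.sum_singleton]

theorem exists_anchor_eq (h : IsLLPacking P S) {p : ℝ × ℝ} (hp : p ∈ P) : ∃ s ∈ S, s.anchor = p :=
  (h.existsUnique p hp).exists

theorem isSidePacking_sideAt (h : IsLLPacking P S) (hP : ∀ p ∈ P, p ∈ unitSquare) :
    IsSidePacking P (sideAt S) where
  eq_zero p hp := by
    refine Finset.sum_eq_zero fun s hs => ?_
    obtain ⟨hsS, rfl⟩ := Finset.mem_filter.1 hs
    exact (hp (h.anchor_mem s hsS)).elim
  nonneg p := Finset.sum_nonneg fun s _ => s.side_nonneg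
  fitsAt p hp := by
    obtain ⟨s, hs, rfl⟩ := h.exists_anchor_eq hp
    rw [h.sideAt_anchor hs, LLSquare.fitsAt_iff P (hP _ hp)]
    exact ⟨h.subset_unitSquare s hs, h.isEmptyOf s hs⟩
  disjoint p hp q hq hpq := by
    obtain ⟨s, hs, rfl⟩ := h.exists_anchor_eq hp
    obtain ⟨t, ht, rfl⟩ := h.exists_anchor_eq hq
    simp only [Function.onFun, h.sideAt_anchor hs, h.sideAt_anchor ht]
    exact LLSquare.interiorDisjoint_iff.1
      (h.interiorDisjoint s hs t ht (ne_of_apply_ne LLSquare.anchor hpq))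

theorem totalArea_eq (h : IsLLPacking P S) : totalArea S = ∑ p ∈ P, sideAt S p ^ 2 :=
  Finset.sum_nbij LLSquare.anchor h.anchor_mem h.anchor_injOn
    (fun p hp => h.exists_anchor_eq hp)
    fun s hs => by rw [h.sideAt_anchor hs, LLSquare.area]

end IsLLPacking

theorem exists_isOptimalLLPacking {P : Finset (ℝ × ℝ)} (hP : ∀ p ∈ P, p ∈ unitSquare) :
    ∃ T, IsOptimalLLPacking P T := by
  obtain ⟨f, hf, hmax⟩ := (isCompact_setOf_isSidePacking hP).exists_isMaxOn
    ⟨0, isSidePacking_zero hP⟩ (f := fun f : ℝ × ℝ → ℝ => ∑ p ∈ P, f p ^ 2) (by fun_prop)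
  obtain ⟨T, hT, harea⟩ := hf.exists_isLLPacking hP
  refine ⟨T, hT, fun T' hT' => ?_⟩
  rw [harea, hT'.totalArea_eq]
  exact hmax (hT'.isSidePacking_sideAt hP)

/-! ### The greedy algorithm -/

section Greedy

variable {P Q : Finset (ℝ × ℝ)} {S : Finset LLSquare} {s : LLSquare} {q : ℝ × ℝ} {r : ℝ}

theorem isAdmissible_iff (hq : q ∈ unitSquare) :
    IsAdmissible P S q s ↔ s.anchor = q ∧ FitsAt P q s.side ∧
      ∀ t ∈ S, Disjoint (openSq q s.side) (openSq t.anchor t.side) := by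
  constructor
  · rintro ⟨rfl, hsub, hempty, hdisj⟩
    exact ⟨rfl, (LLSquare.fitsAt_iff P hq).2 ⟨hsub, hempty⟩,
      fun t ht => LLSquare.interiorDisjoint_iff.1 (hdisj t ht)⟩
  · rintro ⟨rfl, hfits, hdisj⟩
    obtain ⟨hsub, hempty⟩ := (LLSquare.fitsAt_iff P hq).1 hfits
    exact ⟨rfl, hsub, hempty, fun t ht => LLSquare.interiorDisjoint_iff.2 (hdisj t ht)⟩

theorem exists_isCandidate (P : Finset (ℝ × ℝ)) (S : Finset LLSquare) (hq : q ∈ unitSquare) :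
    ∃ s, IsCandidate P S q s := by
  let K : Set ℝ := Set.Icc 0 1 ∩ ({r | FitsAt P q r} ∩
    ⋂ t ∈ S, {r | Disjoint (openSq q r) (openSq t.anchor t.side)})
  have hK : IsCompact K := isCompact_Icc.inter_right <|
    (isClosed_setOf_fitsAt continuous_id P q).inter <| isClosed_biInter fun t _ =>
      isClosed_setOf_disjoint_openSq continuous_id continuous_const q t.anchor
  have hK_iff {r : ℝ} : r ∈ K ↔ r ∈ Set.Icc 0 1 ∧ FitsAt P q r ∧
      ∀ t ∈ S, Disjoint (openSq q r) (openSq t.anchor t.side) := by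
    simp only [K, Set.mem_inter_iff, Set.mem_iInter, Set.mem_ofPred_eq]
  have hzero : (0 : ℝ) ∈ K :=
    hK_iff.2 ⟨⟨le_rfl, zero_le_one⟩, fitsAt_zero P hq, by simp [openSq_zero]⟩
  obtain ⟨r, hr, hmax⟩ := hK.exists_isGreatest ⟨0, hzero⟩
  obtain ⟨⟨hr₀, -⟩, hfits, hdisj⟩ := hK_iff.1 hr
  refine ⟨⟨q, r, hr₀⟩, (isAdmissible_iff hq).2 ⟨rfl, hfits, hdisj⟩, fun s hs => ?_⟩
  obtain ⟨-, hsfits, hsdisj⟩ := (isAdmissible_iff hq).1 hs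
  exact LLSquare.area_le_area_iff.2
    (hmax (hK_iff.2 ⟨⟨s.side_nonneg, hsfits.le_one hq⟩, hsfits, hsdisj⟩))

theorem le_side_of_forall_isCandidate
    (hmax : ∀ q' ∈ Q, ∀ s', IsCandidate P S q' s' → s'.area ≤ s.area) (hq : q ∈ Q)
    (hqu : q ∈ unitSquare) (hfits : FitsAt P q r)
    (hdisj : ∀ t ∈ S, Disjoint (openSq q r) (openSq t.anchor t.side)) : r ≤ s.side := by
  rcases lt_or_ge r 0 with hr | hr
  · exact hr.le.trans s.side_nonneg
  · obtain ⟨c, hc⟩ := exists_isCandidate P S hqu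
    have hle := hc.2 ⟨q, r, hr⟩ ((isAdmissible_iff hqu).2 ⟨rfl, hfits, hdisj⟩)
    exact LLSquare.area_le_area_iff.1 (hle.trans (hmax q hq c hc))

theorem GreedyReaches.subset (h : GreedyReaches P Q S) : Q ⊆ P := by
  induction h with
  | init => exact subset_rfl
  | step _ _ _ _ ih => exact (Finset.erase_subset _ _).trans ih

theorem GreedyReaches.exists_isGreedyOutput (hP : ∀ p ∈ P, p ∈ unitSquare)
    (h : GreedyReaches P Q S) : ∃ S', IsGreedyOutput P S' := by
  classical
  induction hn : Q.card generalizing Q S with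
  | zero =>
    obtain rfl := Finset.card_eq_zero.1 hn
    exact ⟨S, h⟩
  | succ n ih =>
    have hne : Q.Nonempty := Finset.card_pos.1 (by lia)
    have : Nonempty LLSquare := ⟨⟨0, 0, le_rfl⟩⟩
    choose! c hc using fun q (hq : q ∈ Q) => exists_isCandidate P S (hP q (h.subset hq))
    obtain ⟨q, hq, hmax⟩ := Q.exists_max_image (fun q => (c q).area) hne
    refine ih (h.step hq (hc q hq) fun q' hq' s' hs' =>
      ((hc q' hq').2 s' hs'.1).trans (hmax q' hq')) ?_
    rw [Finset.card_erase_of_mem hq, hn, Nat.add_sub_cancel]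

theorem IsLLPacking.insert [DecidableEq LLSquare] (h : IsLLPacking P S) (hs : s.anchor ∉ P)
    (hsub : s.toSet ⊆ unitSquare) (hempty : ∀ t ∈ insert s S, t.IsEmptyOf (insert s.anchor P))
    (hdisj : ∀ t ∈ S, s.InteriorDisjoint t) :
    IsLLPacking (insert s.anchor P) (insert s S) where
  anchor_mem := (Finset.forall_mem_insert ..).2
    ⟨Finset.mem_insert_self .., fun t ht => Finset.mem_insert_of_mem (h.anchor_mem t ht)⟩
  existsUnique := by
    refine (Finset.forall_mem_insert ..).2
      ⟨⟨s, ⟨Finset.mem_insert_self .., rfl⟩, ?_⟩, fun p hp => ?_⟩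
    · rintro t ⟨ht, hts⟩
      exact (Finset.mem_insert.1 ht).resolve_right fun ht => hs (hts ▸ h.anchor_mem t ht)
    · obtain ⟨t, ⟨ht, htp⟩, hunique⟩ := h.existsUnique p hp
      refine ⟨t, ⟨Finset.mem_insert_of_mem ht, htp⟩, ?_⟩
      rintro t' ⟨ht', rfl⟩
      exact hunique t' ⟨(Finset.mem_insert.1 ht').resolve_left fun heq => hs (heq ▸ hp), rfl⟩
  subset_unitSquare := (Finset.forall_mem_insert ..).2 ⟨hsub, h.subset_unitSquare⟩
  isEmptyOf := hempty
  interiorDisjoint := by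
    rintro t ht t' ht' hne
    rcases Finset.mem_insert.1 ht with rfl | htS <;> rcases Finset.mem_insert.1 ht' with rfl | htS'
    · exact (hne rfl).elim
    · exact hdisj t' htS'
    · exact (hdisj t htS).symm
    · exact h.interiorDisjoint t htS t' htS' hne

theorem GreedyReaches.isEmptyOf (h : GreedyReaches P Q S) : ∀ s ∈ S, s.IsEmptyOf P := by
  classical
  induction h with
  | init => simp
  | step _ _ hc _ ih => exact (Finset.forall_mem_insert ..).2 ⟨hc.1.isEmptyOf, ih⟩

theorem GreedyReaches.isLLPacking_sdiff (h : GreedyReaches P Q S) :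
    IsLLPacking (P \ Q) S := by
  classical
  induction h with
  | init => exact ⟨by simp, by simp, by simp, by simp, by simp⟩
  | @step Q S q s hr hq hc hmax ih =>
    have hqP := hr.subset hq
    have hempty := (hr.step hq hc hmax).isEmptyOf
    have hsub : insert q (P \ Q) ⊆ P := Finset.insert_subset hqP Finset.sdiff_subset
    obtain rfl := hc.1.anchor_eq
    have hinsert := ih.insert (s := s) (by simp [hq]) hc.1.subset_unitSquare
      (fun t ht p hp => hempty t ht p (hsub hp)) hc.1.interiorDisjoint
    rwa [← Finset.sdiff_erase hqP] at hinsert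

theorem IsGreedyOutput.isLLPacking (h : IsGreedyOutput P S) : IsLLPacking P S := by
  classical
  simpa using GreedyReaches.isLLPacking_sdiff h

end Greedy

/-! ### The approximation guarantee -/

section Guarantee

variable {P Q : Finset (ℝ × ℝ)} {S T : Finset LLSquare} {f : ℝ × ℝ → ℝ} {q : ℝ × ℝ} {a : ℝ}

theorem IsSidePacking.shrunkSide (hf : IsSidePacking P f) (ha : FitsAt P q a) :
    IsSidePacking P fun p => shrunkSide q a p (f p) := by
  refine hf.mono (fun p => ?_) fun p => shrunkSide_le
  by_cases hp : p ∈ P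
  · exact shrunkSide_nonneg (hf.nonneg p) (ha.notMem p hp)
  · rw [hf.eq_zero p hp, shrunkSide_of_disjoint (by simp [openSq_zero])]

theorem GreedyReaches.exists_shrunk (hP : ∀ p ∈ P, p ∈ unitSquare) (hf : IsSidePacking P f)
    (h : GreedyReaches P Q S) :
    ∃ r, IsSidePacking P r ∧ (∀ p ∉ Q, r p = 0) ∧
      (∀ p, ∀ t ∈ S, Disjoint (openSq p (r p)) (openSq t.anchor t.side)) ∧
      ∑ p ∈ P, f p ^ 2 ≤ ∑ p ∈ P, r p ^ 2 + 3 * totalArea S := by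
  classical
  induction h with
  | init => exact ⟨f, hf, hf.eq_zero, by simp, by simp [totalArea]⟩
  | @step Q S q s hr hq hc hmax ih =>
    obtain ⟨r, hrP, hrQ, hrS, hsum⟩ := ih
    have hqP := hr.subset hq
    obtain ⟨hanchor, hfits, -⟩ := (isAdmissible_iff (hP q hqP)).1 hc.1
    have hrs : ∀ p, r p ≤ s.side := fun p => by
      by_cases hp : p ∈ Q
      · have hpP := hr.subset hp
        exact le_side_of_forall_isCandidate hmax hp (hP p hpP) (hrP.fitsAt p hpP) (hrS p)
      · exact hrQ p hp ▸ s.side_nonneg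
    refine ⟨fun p => shrunkSide q s.side p (r p), hrP.shrunkSide hfits, fun p hp => ?_,
      fun p => (Finset.forall_mem_insert ..).2 ⟨?_, fun t ht => ?_⟩, ?_⟩
    · refine le_antisymm ?_ ((hrP.shrunkSide hfits).nonneg p)
      by_cases hpq : p = q
      · subst hpq
        exact nonpos_of_disjoint_openSq_self (shrunkSide_le.trans (hrs p))
          disjoint_openSq_shrunkSide
      · exact shrunkSide_le.trans (hrQ p fun hpQ => hp (Finset.mem_erase.2 ⟨hpq, hpQ⟩)).le
    · exact hanchor ▸ disjoint_openSq_shrunkSide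
    · exact (hrS p t ht).mono_left (openSq_mono shrunkSide_le)
    · have hcost := sum_sq_sub_shrunkSide_sq_le (c := fun p => p) (p := q) s.side_nonneg
        (fun p _ => hrs p) hrP.disjoint (fun p hp => (hrP.fitsAt p hp).notMem q hqP) hfits.notMem
      have hsS : s ∉ S := fun hs =>
        (Finset.mem_sdiff.1 (hr.isLLPacking_sdiff.anchor_mem s hs)).2 (hanchor ▸ hq)
      rw [Finset.sum_sub_distrib] at hcost
      rw [totalArea, Finset.sum_insert hsS, ← totalArea, LLSquare.area]
      linarith

theorem IsGreedyOutput.totalArea_le_three_mul (hP : ∀ p ∈ P, p ∈ unitSquare)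
    (h : IsGreedyOutput P S) (hT : IsLLPacking P T) : totalArea T ≤ 3 * totalArea S := by
  obtain ⟨r, -, hzero, -, hsum⟩ := GreedyReaches.exists_shrunk hP (hT.isSidePacking_sideAt hP) h
  have hr : ∑ p ∈ P, r p ^ 2 = 0 := Finset.sum_eq_zero fun p _ => by simp [hzero p]
  rw [hT.totalArea_eq]
  linarith

end Guarantee

/-! ### Sharpness -/

theorem GreedyReaches.exists_forall_fitsAt_le {P Q : Finset (ℝ × ℝ)} {S : Finset LLSquare}
    (hP : ∀ p ∈ P, p ∈ unitSquare) (h : GreedyReaches P Q S) :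
    (Q = P ∧ S = ∅) ∨ ∃ s ∈ S, ∀ q ∈ P, ∀ r, FitsAt P q r → r ≤ s.side := by
  classical
  induction h with
  | init => exact .inl ⟨rfl, rfl⟩
  | @step Q S q s _ _ _ hmax ih =>
    right
    rcases ih with ⟨rfl, rfl⟩ | ⟨t, ht, hlargest⟩
    · exact ⟨s, Finset.mem_insert_self .., fun q hq r hr =>
        le_side_of_forall_isCandidate hmax hq (hP q hq) hr (by simp)⟩
    · exact ⟨t, Finset.mem_insert_of_mem ht, hlargest⟩

theorem IsGreedyOutput.exists_forall_fitsAt_le {P : Finset (ℝ × ℝ)} {S : Finset LLSquare}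
    (hP : ∀ p ∈ P, p ∈ unitSquare) (hne : P.Nonempty) (h : IsGreedyOutput P S) :
    ∃ s ∈ S, ∀ q ∈ P, ∀ r, FitsAt P q r → r ≤ s.side :=
  (GreedyReaches.exists_forall_fitsAt_le hP h).resolve_left fun hinit => hne.ne_empty hinit.1.symm

/-- The lower-left corners of three of the four quadrants of the unit square. -/
noncomputable def quadrantCorners : Finset (ℝ × ℝ) :=
  {(0, 0), (0, 1 / 2), (1 / 2, 0)}

/-- The points `(1 / 2 + i * η, 1 / 2 + i * η)` for `1 ≤ i ≤ N`. For `N * η = 1 / 2` they divide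
the diagonal of the upper right quadrant evenly, and the last one is `(1, 1)`. -/
noncomputable def diagonalPoints (N : ℕ) (η : ℝ) : Finset (ℝ × ℝ) :=
  (Finset.Icc 1 N).image fun i : ℕ => (1 / 2 + i * η, 1 / 2 + i * η)

/-- The point set showing that the constant `1 / 3` is sharp in the limit `η → 0`, where
`N * η = 1 / 2`. -/
noncomputable def badPoints (N : ℕ) (η : ℝ) : Finset (ℝ × ℝ) :=
  quadrantCorners ∪ diagonalPoints N η

theorem mem_quadrantCorners {p : ℝ × ℝ} :
    p ∈ quadrantCorners ↔ p = (0, 0) ∨ p = (0, 1 / 2) ∨ p = (1 / 2, 0) := by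
  simp [quadrantCorners]

theorem pairwiseDisjoint_openSq_quadrantCorners :
    (quadrantCorners : Set (ℝ × ℝ)).PairwiseDisjoint fun p => openSq p (1 / 2) := by
  intro p hp q hq hpq
  by_contra hover
  rw [Function.onFun, not_disjoint_openSq] at hover
  rcases mem_quadrantCorners.1 hp with rfl | rfl | rfl <;>
    rcases mem_quadrantCorners.1 hq with rfl | rfl | rfl <;>
    first | exact hpq rfl | norm_num at hover

section BadPoints

variable {N : ℕ} {η r : ℝ} {p : ℝ × ℝ} {S T : Finset LLSquare} {f : ℝ × ℝ → ℝ}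

theorem mem_badPoints : p ∈ badPoints N η ↔ p ∈ quadrantCorners ∨
    ∃ i : ℕ, (1 ≤ i ∧ i ≤ N) ∧ (1 / 2 + i * η, 1 / 2 + i * η) = p := by
  simp [badPoints, diagonalPoints]

theorem zero_mem_badPoints (N : ℕ) (η : ℝ) : (0, 0) ∈ badPoints N η :=
  mem_badPoints.2 (.inl (mem_quadrantCorners.2 (.inl rfl)))

theorem mem_Icc_of_mem_diagonalPoints (hη : 0 < η) (hN : N * η = 1 / 2)
    (hp : p ∈ diagonalPoints N η) : p.1 ∈ Set.Icc (1 / 2 + η) 1 ∧ p.2 ∈ Set.Icc (1 / 2 + η) 1 := by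
  simp only [diagonalPoints, Finset.mem_image, Finset.mem_Icc] at hp
  obtain ⟨i, ⟨h₁, hiN⟩, rfl⟩ := hp
  have hlow : (1 : ℝ) * η ≤ i * η := by gcongr; exact_mod_cast h₁
  have hhigh : (i : ℝ) * η ≤ N * η := by gcongr
  constructor <;> constructor <;> dsimp only <;> linarith

theorem badPoints_subset_unitSquare (hη : 0 < η) (hN : N * η = 1 / 2) :
    ∀ p ∈ badPoints N η, p ∈ unitSquare := by
  intro p hp
  rcases Finset.mem_union.1 hp with hp | hp
  · rcases mem_quadrantCorners.1 hp with rfl | rfl | rfl <;> norm_num [unitSquare]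
  · obtain ⟨⟨h₁, h₂⟩, h₃, h₄⟩ := mem_Icc_of_mem_diagonalPoints hη hN hp
    exact ⟨⟨by linarith, h₂⟩, by linarith, h₄⟩

theorem fitsAt_quadrantCorner (hη : 0 < η) (hN : N * η = 1 / 2) (hp : p ∈ quadrantCorners) :
    FitsAt (badPoints N η) p (1 / 2) := by
  refine ⟨?_, ?_, fun q hq hmem => ?_⟩
  · rcases mem_quadrantCorners.1 hp with rfl | rfl | rfl <;> norm_num
  · rcases mem_quadrantCorners.1 hp with rfl | rfl | rfl <;> norm_num
  · rw [mem_openSq] at hmem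
    rcases Finset.mem_union.1 hq with hq | hq
    · rcases mem_quadrantCorners.1 hp with rfl | rfl | rfl <;>
        rcases mem_quadrantCorners.1 hq with rfl | rfl | rfl <;> norm_num at hmem
    · obtain ⟨⟨h₁, -⟩, h₂, -⟩ := mem_Icc_of_mem_diagonalPoints hη hN hq
      rcases mem_quadrantCorners.1 hp with rfl | rfl | rfl <;> norm_num at hmem <;> linarith

open Classical in
theorem isSidePacking_quadrants (hη : 0 < η) (hN : N * η = 1 / 2) :
    IsSidePacking (badPoints N η) fun p => if p ∈ quadrantCorners then 1 / 2 else 0 where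
  eq_zero p hp := if_neg fun hmem => hp (Finset.mem_union_left _ hmem)
  nonneg p := by split_ifs <;> norm_num
  fitsAt p hp := by
    split_ifs with hmem
    · exact fitsAt_quadrantCorner hη hN hmem
    · exact fitsAt_zero _ (badPoints_subset_unitSquare hη hN p hp)
  disjoint p _ q _ hpq := by
    by_cases h : p ∈ quadrantCorners ∧ q ∈ quadrantCorners
    · simpa only [Function.onFun, if_pos h.1, if_pos h.2] using
        pairwiseDisjoint_openSq_quadrantCorners h.1 h.2 hpq
    · rcases not_and_or.1 h with h | h <;> simp [Function.onFun, if_neg h, openSq_zero]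

theorem IsOptimalLLPacking.three_quarters_le (hη : 0 < η) (hN : N * η = 1 / 2)
    (hT : IsOptimalLLPacking (badPoints N η) T) : 3 / 4 ≤ totalArea T := by
  classical
  obtain ⟨T', hT', harea⟩ := (isSidePacking_quadrants hη hN).exists_isLLPacking
    (badPoints_subset_unitSquare hη hN)
  have hcard : quadrantCorners.card = 3 := by simp [quadrantCorners]
  calc (3 / 4 : ℝ) = ∑ p ∈ quadrantCorners, (1 / 2) ^ 2 := by
        rw [Finset.sum_const, hcard]; norm_num
    _ = ∑ p ∈ quadrantCorners, (if p ∈ quadrantCorners then 1 / 2 else 0 : ℝ) ^ 2 :=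
        Finset.sum_congr rfl fun p hp => by rw [if_pos hp]
    _ ≤ ∑ p ∈ badPoints N η, (if p ∈ quadrantCorners then 1 / 2 else 0 : ℝ) ^ 2 :=
        Finset.sum_le_sum_of_subset_of_nonneg Finset.subset_union_left fun _ _ _ => sq_nonneg _
    _ = totalArea T' := harea.symm
    _ ≤ totalArea T := hT.2 T' hT'

theorem fitsAt_zero_badPoints_iff (hη : 0 < η) (hN : N * η = 1 / 2) :
    FitsAt (badPoints N η) (0, 0) r ↔ r ≤ 1 / 2 + η := by
  have hN₁ : 1 ≤ N := Nat.one_le_iff_ne_zero.2 fun h => by norm_num [h] at hN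
  have hfirst : (1 / 2 + η, 1 / 2 + η) ∈ badPoints N η :=
    mem_badPoints.2 (.inr ⟨1, ⟨le_rfl, hN₁⟩, by simp⟩)
  have hη_le : 1 / 2 + η ≤ 1 := by
    have hle : (1 : ℝ) * η ≤ N * η := by gcongr; exact_mod_cast hN₁
    linarith
  constructor
  · intro h
    by_contra! hlt
    exact h.notMem _ hfirst
      ⟨⟨by dsimp only; linarith, by simpa using hlt⟩, by dsimp only; linarith, by simpa using hlt⟩
  · intro hr
    refine FitsAt.mono ⟨by simpa using hη_le, by simpa using hη_le, fun p hp hmem => ?_⟩ hr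
    obtain ⟨⟨h₁, h₂⟩, h₃, -⟩ := mem_openSq.1 hmem
    rcases Finset.mem_union.1 hp with hp | hp
    · rcases mem_quadrantCorners.1 hp with rfl | rfl | rfl <;> simp at h₁ h₃
    · linarith [(mem_Icc_of_mem_diagonalPoints hη hN hp).1.1]

theorem FitsAt.le_half_of_mem_badPoints (hη : 0 < η) (hN : N * η = 1 / 2)
    (hp : p ∈ badPoints N η) (hne : p ≠ (0, 0)) (h : FitsAt (badPoints N η) p r) : r ≤ 1 / 2 := by
  have hfst := h.fst_le
  have hsnd := h.snd_le
  rcases Finset.mem_union.1 hp with hp | hp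
  · rcases mem_quadrantCorners.1 hp with rfl | rfl | rfl
    · exact (hne rfl).elim
    · linarith
    · linarith
  · linarith [(mem_Icc_of_mem_diagonalPoints hη hN hp).1.1]

theorem IsGreedyOutput.sideAt_zero_badPoints (hη : 0 < η) (hN : N * η = 1 / 2)
    (h : IsGreedyOutput (badPoints N η) S) : sideAt S (0, 0) = 1 / 2 + η := by
  have hunit := badPoints_subset_unitSquare hη hN
  have hzero := zero_mem_badPoints N η
  obtain ⟨s, hs, hlargest⟩ := h.exists_forall_fitsAt_le hunit ⟨_, hzero⟩
  have hanchor := h.isLLPacking.anchor_mem s hs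
  have hfits : FitsAt (badPoints N η) s.anchor s.side :=
    (LLSquare.fitsAt_iff _ (hunit _ hanchor)).2
      ⟨h.isLLPacking.subset_unitSquare s hs, h.isLLPacking.isEmptyOf s hs⟩
  have hlarge : 1 / 2 + η ≤ s.side :=
    hlargest _ hzero _ ((fitsAt_zero_badPoints_iff hη hN).2 le_rfl)
  have horigin : s.anchor = (0, 0) := by
    by_contra hne
    linarith [hfits.le_half_of_mem_badPoints hη hN hanchor hne]
  rw [← horigin, h.isLLPacking.sideAt_anchor hs]
  exact le_antisymm ((fitsAt_zero_badPoints_iff hη hN).1 (horigin ▸ hfits)) hlarge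

theorem IsSidePacking.le_of_mem_badPoints (hη : 0 < η) (hN : N * η = 1 / 2)
    (hf : IsSidePacking (badPoints N η) f) (hzero : f (0, 0) = 1 / 2 + η)
    (hp : p ∈ badPoints N η) (hne : p ≠ (0, 0)) : f p ≤ η := by
  by_contra! hlt
  rcases mem_badPoints.1 hp with hp' | ⟨i, ⟨-, hiN⟩, rfl⟩
  · refine not_disjoint_openSq.2 ⟨⟨by linarith, by linarith⟩, ?_⟩
      (hf.disjoint hp (zero_mem_badPoints N η) hne)
    rw [hzero]
    rcases mem_quadrantCorners.1 hp' with rfl | rfl | rfl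
    · exact (hne rfl).elim
    all_goals constructor <;> constructor <;> dsimp only <;> linarith
  · rcases hiN.eq_or_lt with rfl | hlast
    · have hfst := (hf.fitsAt _ hp).fst_le
      dsimp only at hfst
      linarith
    · have hnext : (1 / 2 + (i + 1 : ℕ) * η, 1 / 2 + (i + 1 : ℕ) * η) ∈ badPoints N η :=
        mem_badPoints.2 (.inr ⟨i + 1, ⟨by lia, hlast⟩, rfl⟩)
      refine (hf.fitsAt _ hp).notMem _ hnext ⟨⟨?_, ?_⟩, ?_, ?_⟩ <;> push_cast <;> linarith

theorem card_badPoints_erase_zero_le (N : ℕ) (η : ℝ) :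
    ((badPoints N η).erase (0, 0)).card ≤ N + 2 := by
  have hcard : (badPoints N η).card ≤ 3 + N :=
    (Finset.card_union_le _ _).trans
      (add_le_add Finset.card_le_three (Finset.card_image_le.trans (by simp)))
  rw [Finset.card_erase_of_mem (zero_mem_badPoints N η)]
  lia

theorem IsGreedyOutput.totalArea_badPoints_le (hη : 0 < η) (hN : N * η = 1 / 2)
    (h : IsGreedyOutput (badPoints N η) S) : totalArea S ≤ 1 / 4 + 3 / 2 * η + 3 * η ^ 2 := by
  have hzero := h.sideAt_zero_badPoints hη hN
  have hpacking := h.isLLPacking.isSidePacking_sideAt (badPoints_subset_unitSquare hη hN)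
  have hsmall : ∀ p ∈ (badPoints N η).erase (0, 0), sideAt S p ^ 2 ≤ η ^ 2 := fun p hp =>
    pow_le_pow_left₀ (hpacking.nonneg p) (hpacking.le_of_mem_badPoints hη hN hzero
      (Finset.mem_of_mem_erase hp) (Finset.ne_of_mem_erase hp)) 2
  calc totalArea S
      = sideAt S (0, 0) ^ 2 + ∑ p ∈ (badPoints N η).erase (0, 0), sideAt S p ^ 2 := by
        rw [h.isLLPacking.totalArea_eq,
          Finset.add_sum_erase _ (fun p => sideAt S p ^ 2) (zero_mem_badPoints N η)]
    _ ≤ (1 / 2 + η) ^ 2 + (N + 2 : ℕ) • η ^ 2 := by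
        rw [hzero]
        gcongr
        exact (Finset.sum_le_card_nsmul _ _ _ hsmall).trans
          (nsmul_le_nsmul_left (sq_nonneg η) (card_badPoints_erase_zero_le N η))
    _ = 1 / 4 + η + N * η * η + 3 * η ^ 2 := by rw [nsmul_eq_mul]; push_cast; ring
    _ = 1 / 4 + 3 / 2 * η + 3 * η ^ 2 := by rw [hN]; ring

end BadPoints

theorem exists_forall_totalArea_lt {ε : ℝ} (hε : 0 < ε) :
    ∃ P : Finset (ℝ × ℝ), (∀ p ∈ P, p ∈ unitSquare) ∧
      ∀ S, IsGreedyOutput P S → ∀ T, IsOptimalLLPacking P T →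
        totalArea S < (1 / 3 + ε) * totalArea T := by
  obtain ⟨n, hn⟩ := exists_nat_one_div_lt (half_pos hε)
  let η : ℝ := 1 / (2 * (n + 1))
  have hη : 0 < η := by positivity
  have hN : (n + 1 : ℕ) * η = 1 / 2 := by simp only [η]; push_cast; field_simp
  have hη_le : η ≤ 1 / 2 := by
    have hle : (1 : ℝ) * η ≤ (n + 1 : ℕ) * η := by gcongr; simp
    linarith
  have hηε : 4 * η < ε := by
    have heq : η = 1 / (n + 1) / 2 := by simp only [η]; field_simp
    linarith
  refine ⟨badPoints (n + 1) η, badPoints_subset_unitSquare hη hN, fun S hS T hT => ?_⟩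
  calc totalArea S ≤ 1 / 4 + 3 / 2 * η + 3 * η ^ 2 := hS.totalArea_badPoints_le hη hN
    _ ≤ 1 / 4 + 3 * η := by nlinarith
    _ < (1 / 3 + ε) * (3 / 4) := by linarith
    _ ≤ (1 / 3 + ε) * totalArea T := by
        gcongr
        exact hT.three_quarters_le hη hN

theorem mainTheorem6 :
    (∀ P : Finset (ℝ × ℝ), (∀ p ∈ P, p ∈ unitSquare) →
      (∃ S, IsGreedyOutput P S) ∧
      (∃ T, IsOptimalLLPacking P T) ∧
      ∀ S, IsGreedyOutput P S →
        IsLLPacking P S ∧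
        ∀ T, IsOptimalLLPacking P T → (1 / 3 : ℝ) * totalArea T ≤ totalArea S) ∧
    (∀ ε : ℝ, 0 < ε →
      ∃ P : Finset (ℝ × ℝ), (∀ p ∈ P, p ∈ unitSquare) ∧
        ∀ S, IsGreedyOutput P S → ∀ T, IsOptimalLLPacking P T →
          totalArea S < (1 / 3 + ε) * totalArea T) := by
  refine ⟨fun P hP => ⟨GreedyReaches.init.exists_isGreedyOutput hP, exists_isOptimalLLPacking hP,
    fun S hS => ⟨hS.isLLPacking, fun T hT => ?_⟩⟩, fun ε hε => exists_forall_totalArea_lt hε⟩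
  linarith [hS.totalArea_le_three_mul hP hT.1]
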